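/- Let $\rho$ and $\sigma$ be quantum states (positive semidefinite operators of trace one) on a common finite-dimensional complex Hilbert space, and let $\varepsilon\in(0,1)$. All logarithms are to base $2$. Write $\|X\|_1=\operatorname{Tr}\sqrt{X^\dagger X}$ and $F(\rho,\rho')=\|\sqrt{\rho}\sqrt{\rho'}\|_1^2$. Let $$D_{\max}(\rho\|\sigma)=\log\inf\{\lambda\ge 0:\rho\le\lambda\sigma\}\qquad(\inf\emptyset=\infty,\ \log\infty=\infty),$$ and define the smooth max-relative entropies with normalised trace-distance and normalised purified-distance smoothing by $$D^{\varepsilon}_{\max,T}(\rho\|\sigma)=\inf\{D_{\max}(\rho'\|\sigma):\ \rho'\ge 0,\ \operatorname{Tr}\rho'=1,\ \tfrac12\|\rho-\rho'\|_1\le\varepsilon\},$$ $$D^{\varepsilon}_{\max,P}(\rho\|\sigma)=\inf\{D_{\max}(\rho'\|\sigma):\ \rho'\ge 0,\ \operatorname{Tr}\rho'=1,\ \sqrt{1-F(\rho,\rho')}\le\varepsilon\}.$$ Let $D(\rho\|\sigma)=\operatorname{Tr}\rho(\log\rho-\log\sigma)$ if $\operatorname{supp}\rho\subseteq\operatorname{supp}\sigma$,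 and $D(\rho\|\sigma)=\infty$ otherwise, denote the Umegaki relative entropy. Then $$D^{\varepsilon}_{\max,T}(\rho\|\sigma)\ \le\ D^{\varepsilon}_{\max,P}(\rho\|\sigma)\ \le\ \frac{D(\rho\|\sigma)+1}{\varepsilon^2}-\log\frac{1}{\varepsilon^2}.$$ -/

import Mathlib

open scoped NNReal ENNReal ComplexOrder

noncomputable section

namespace SmoothDivergence

variable {n : Type*} [Fintype n] [DecidableEq n]

/-- Quantum states on the Hilbert space `ℂⁿ`: positive semidefinite matrices of trace one. -/
def IsState (ρ : Matrix n n ℂ) : Prop :=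
  ρ.PosSemidef ∧ ρ.trace = 1

/-- The square root of a positive semidefinite matrix, by functional calculus. -/
def msqrt (A : Matrix n n ℂ) : Matrix n n ℂ :=
  cfc Real.sqrt A

/-- The base-2 logarithm of a positive semidefinite matrix, by functional calculus.
Since `Real.logb 2 0 = 0`, this is the logarithm taken on the support and zero on the kernel. -/
def mlog (A : Matrix n n ℂ) : Matrix n n ℂ :=
  cfc (Real.logb 2) A

/-- The Schatten 1-norm `Tr √(X† X)`. -/
def traceNorm (X : Matrix n n ℂ) : ℝ :=
  (msqrt (X.conjTranspose * X)).trace.re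

/-- The trace distance `½ ‖ρ - ρ'‖₁`. -/
def traceDist (ρ ρ' : Matrix n n ℂ) : ℝ :=
  (1 / 2) * traceNorm (ρ - ρ')

/-- The (squared) Uhlmann fidelity `‖√ρ √ρ'‖₁²`. -/
def fidelity (ρ ρ' : Matrix n n ℂ) : ℝ :=
  traceNorm (msqrt ρ * msqrt ρ') ^ 2

/-- The purified distance `√(1 - F(ρ, ρ'))`. -/
def purifiedDist (ρ ρ' : Matrix n n ℂ) : ℝ :=
  Real.sqrt (1 - fidelity ρ ρ')

/-- The base-2 logarithm `[0, ∞] → [-∞, ∞]`, with `log 0 = -∞` and `log ∞ = ∞`. -/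
def elog2 (x : ℝ≥0∞) : EReal :=
  ENNReal.log x / ((Real.log 2 : ℝ) : EReal)

/-- The max-relative entropy `log inf {l ≥ 0 : ρ ≤ l σ}` (Löwner order, `inf ∅ = ∞`). -/
def Dmax (ρ σ : Matrix n n ℂ) : EReal :=
  elog2 (⨅ (l : ℝ≥0) (_ : ((l : ℝ) • σ - ρ).PosSemidef), (l : ℝ≥0∞))

/-- The ball of normalised states within trace distance `ε` of `ρ`. -/
def traceBall (ε : ℝ) (ρ : Matrix n n ℂ) : Set (Matrix n n ℂ) :=
  {ρ' | traceDist ρ ρ' ≤ ε ∧ IsState ρ'}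

/-- The ball of normalised states within purified distance `ε` of `ρ`. -/
def purifiedBall (ε : ℝ) (ρ : Matrix n n ℂ) : Set (Matrix n n ℂ) :=
  {ρ' | purifiedDist ρ ρ' ≤ ε ∧ IsState ρ'}

/-- The smooth max-relative entropy with normalised trace-distance smoothing. -/
def DmaxTrace (ε : ℝ) (ρ σ : Matrix n n ℂ) : EReal :=
  ⨅ ρ' ∈ traceBall ε ρ, Dmax ρ' σ

/-- The smooth max-relative entropy with normalised purified-distance smoothing. -/
def DmaxPurified (ε : ℝ) (ρ σ : Matrix n n ℂ) : EReal :=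
  ⨅ ρ' ∈ purifiedBall ε ρ, Dmax ρ' σ

open Classical in
/-- The Umegaki relative entropy `Tr ρ (log ρ - log σ)` in bits, equal to `∞` unless
`supp ρ ⊆ supp σ`. The support of a Hermitian matrix is its range. -/
def relEntropy (ρ σ : Matrix n n ℂ) : EReal :=
  if LinearMap.range ρ.mulVecLin ≤ LinearMap.range σ.mulVecLin then
    (((ρ * (mlog ρ - mlog σ)).trace.re : ℝ) : EReal)
  else ⊤

end SmoothDivergence

end

section
open Matrix

namespace SmoothDivergence

section

/-! The first inequality is Fuchs-van de Graaf (`traceDist_le_purifiedDist`): the purified ball lies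
inside the trace ball.

For the second, put `x = ε²` and cut `ρ` at a threshold `l σ`. If `Q` is the positive part of `ρ - l
σ`, then `ρ ≤ B` with `B = l σ + Q`. Writing `A = l σ` as `G B G` with `0 ≤ G ≤ 1`
(`exists_sandwich_eq`), the normalisation `τ` of `G ρ G` satisfies `τ ≤ A / Tr(ρ G²)`. If `Tr Q ≤
x`, then `Tr(ρ G²) ≥ 1 - x`, and the fidelity of `ρ` and `τ` is at least `1 - x`
(`exists_state_le_of_le`). The factor `1 / (1 - x)` is paid for by a term `log (1 - x)` in `log l`.

It remains to bound `Tr Q` (`trace_posPart_le`). Measuring the projection onto `ρ > l σ` and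
applying data processing (`binary_le_relEntropy`) reduces this to the scalar inequality
`neg_mul_log_lt`. Data processing itself is proved by hand: in the two eigenbases the relative
entropy is a classical one with weights `|⟨u_i, v_j⟩|²`. It is recovered by integrating over `s` the
functionals `∑ w P² / (Q + s P)`, each of which has a variational formula over Hermitian `X` that
can be tested on the measurement. -/

/-! ### Real inequalities -/

/-- Completing the square in the quadratic form that represents `p ^ 2 / (q + s * p)`. -/
theorem two_mul_re_sub_le (z y : ℂ) {p q s : ℝ} (hp : 0 ≤ p) (hq : 0 ≤ q) (hs : 0 < s) :
    2 * (p * (z * star y).re) - q * Complex.normSq y - s * (p * Complex.normSq y)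
      ≤ Complex.normSq z * (p ^ 2 / (q + s * p)) := by
  rcases hp.eq_or_lt with rfl | hp
  · simp only [zero_mul, mul_zero, zero_sub, sub_zero]
    have := mul_nonneg hq (Complex.normSq_nonneg y)
    norm_num
    linarith
  have hD : 0 < q + s * p := by positivity
  have h : 0 ≤ Complex.normSq ((p : ℂ) * z - ((q + s * p : ℝ) : ℂ) * y) := Complex.normSq_nonneg _
  rw [Complex.normSq_sub] at h
  simp only [map_mul, Complex.normSq_ofReal] at h
  have e : ((p : ℂ) * z * (starRingEnd ℂ (((q + s * p : ℝ) : ℂ)) * starRingEnd ℂ y)).re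
      = p * (q + s * p) * (z * star y).re := by
    rw [Complex.conj_ofReal]
    simp
    ring
  rw [e] at h
  rw [← mul_div_assoc, le_div_iff₀ hD]
  nlinarith

/-- The alternative `c = 0` serves the index pairs on which `σ` vanishes, where the argument of the
logarithm can be zero. -/
theorem hasDerivAt_const_mul_log {c p q s : ℝ} (h : c = 0 ∨ 0 < q + s * p) :
    HasDerivAt (fun s => c * Real.log (q + s * p)) (c * (p / (q + s * p))) s := by
  rcases h with rfl | h
  · simpa using hasDerivAt_const s (0 : ℝ)
  · have h1 : HasDerivAt (fun s => q + s * p) p s := by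
      simpa using ((hasDerivAt_id s).mul_const p).const_add q
    exact (h1.log h.ne').const_mul c

/-- A pointwise comparison of the resolvent functionals of two pairs of weights integrates to a
comparison of relative entropies. -/
theorem binary_le_sum_mul_log {ι : Type*} [Fintype ι] (w P Q : ι → ℝ) (hw : ∀ i, 0 ≤ w i)
    (hP : ∀ i, 0 ≤ P i) (hQ : ∀ i, 0 ≤ Q i) (hs : ∀ i, Q i = 0 → w i * P i = 0)
    (hP1 : ∑ i, w i * P i = 1) (hQ1 : ∑ i, w i * Q i = 1) {a b : ℝ} (ha0 : 0 ≤ a) (ha1 : a ≤ 1)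
    (hb : 0 < b)
    (h : ∀ s, 0 < s → a ^ 2 / (b + s * a) + (1 - a) ^ 2 / (1 + s * (1 - a))
      ≤ ∑ i, w i * (P i ^ 2 / (Q i + s * P i))) :
    a * Real.log a + (1 - a) * Real.log (1 - a) - a * Real.log b
      ≤ ∑ i, w i * P i * (Real.log (P i) - Real.log (Q i)) := by
  have hpos : ∀ s, 0 ≤ s → ∀ i, w i * P i = 0 ∨ 0 < Q i + s * P i := by
    intro s hs0 i
    by_cases hq : Q i = 0
    · exact Or.inl (hs i hq)
    · right
      have := (hQ i).lt_of_ne' hq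
      have := mul_nonneg hs0 (hP i)
      linarith
  have h1a : 0 ≤ 1 - a := by linarith
  -- The derivative of `H` is the difference of the two sides of `h`. The claim follows by comparing
  -- `H 0` with `H T` as `T → ∞`; the `log T` terms cancel because both first weights have total
  -- mass one.
  let H : ℝ → ℝ := fun s => (∑ i, w i * P i * Real.log (Q i + s * P i))
    - a * Real.log (b + s * a) - (1 - a) * Real.log (1 + s * (1 - a))
  have hH : ∀ s, 0 ≤ s → HasDerivAt H ((∑ i, w i * P i * (P i / (Q i + s * P i)))
      - a * (a / (b + s * a)) - (1 - a) * ((1 - a) / (1 + s * (1 - a)))) s := by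
    intro s hs0
    refine HasDerivAt.sub (HasDerivAt.sub ?_ ?_) ?_
    · exact HasDerivAt.fun_sum fun i _ => hasDerivAt_const_mul_log (hpos s hs0 i)
    · exact hasDerivAt_const_mul_log (Or.inr (by positivity))
    · exact hasDerivAt_const_mul_log (Or.inr (by positivity))
  have hmono : MonotoneOn H (Set.Ici 0) := by
    refine monotoneOn_of_deriv_nonneg (convex_Ici 0)
      (fun s hs0 => (hH s hs0).continuousAt.continuousWithinAt)
      (fun s hs0 => (hH s (interior_subset hs0)).differentiableAt.differentiableWithinAt) ?_
    intro s hs0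
    rw [interior_Ici] at hs0
    rw [(hH s (le_of_lt hs0)).deriv]
    have := h s hs0
    have e : ∑ i, w i * P i * (P i / (Q i + s * P i)) = ∑ i, w i * (P i ^ 2 / (Q i + s * P i)) :=
      Finset.sum_congr rfl fun i _ => by ring
    rw [e]
    have e1 : a * (a / (b + s * a)) = a ^ 2 / (b + s * a) := by ring
    have e2 : (1 - a) * ((1 - a) / (1 + s * (1 - a))) = (1 - a) ^ 2 / (1 + s * (1 - a)) := by ring
    rw [e1, e2]
    linarith
  have key : ∀ T : ℝ, 0 < T → a * Real.log a + (1 - a) * Real.log (1 - a) - a * Real.log b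
      ≤ (∑ i, w i * P i * (Real.log (P i) - Real.log (Q i))) + 1 / T := by
    intro T hT
    have hm := hmono (Set.self_mem_Ici) (Set.mem_Ici.2 hT.le) hT.le
    simp only [H, zero_mul, add_zero, Real.log_one, mul_zero, sub_zero] at hm
    have hlog : ∀ c d : ℝ, 0 ≤ c → 0 ≤ d → c * (Real.log T + Real.log c)
        ≤ c * Real.log (d + T * c) := by
      intro c d hc hd
      rcases hc.eq_or_lt with rfl | hc
      · simp
      · rw [← Real.log_mul hT.ne' hc.ne']
        gcongr
        linarith
    have h1 := hlog a b ha0 hb.le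
    have h2 := hlog (1 - a) 1 h1a zero_le_one
    -- By `log (1 + y) ≤ y`, the errors sum to `(∑ w Q) / T = 1 / T`.
    have h3 : ∀ i, w i * P i * Real.log (Q i + T * P i)
        ≤ w i * P i * Real.log (P i) + w i * P i * Real.log T + w i * Q i * (1 / T) := by
      intro i
      rcases (hP i).eq_or_lt with h0 | h0
      · rw [← h0]
        have := mul_nonneg (hw i) (hQ i)
        have : 0 ≤ w i * Q i * (1 / T) := by positivity
        simpa using this
      · have hTP : 0 < T * P i := by positivity
        have e : Q i + T * P i = T * P i * (1 + Q i / (T * P i)) := by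
          field_simp
          ring
        have hq : 0 ≤ Q i / (T * P i) := div_nonneg (hQ i) hTP.le
        rw [e, Real.log_mul hTP.ne' (by positivity), Real.log_mul hT.ne' h0.ne']
        have hl : Real.log (1 + Q i / (T * P i)) ≤ Q i / (T * P i) := by
          have := Real.log_le_sub_one_of_pos (show 0 < 1 + Q i / (T * P i) by positivity)
          linarith
        have hm' := mul_le_mul_of_nonneg_left hl (mul_nonneg (hw i) h0.le)
        have e2 : w i * P i * (Q i / (T * P i)) = w i * Q i * (1 / T) := by
          field_simp
        linarith
    have h4 := Finset.sum_le_sum fun i (_ : i ∈ Finset.univ) => h3 i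
    rw [Finset.sum_add_distrib, Finset.sum_add_distrib, ← Finset.sum_mul, ← Finset.sum_mul, hP1,
      hQ1] at h4
    simp only [mul_sub, Finset.sum_sub_distrib]
    linarith
  refine le_of_forall_pos_le_add fun δ hδ => ?_
  simpa using key (1 / δ) (by positivity)

/-- The scalar inequality behind the choice of the threshold. -/
theorem neg_mul_log_lt {x p : ℝ} (hx0 : 0 < x) (hxp : x < p) (hp1 : p ≤ 1) :
    -((1 - p) * Real.log (1 - p)) < p * (Real.log 2 / x) + p * Real.log x := by
  have hp : 0 < p := hx0.trans hxp
  -- Convexity of `t log t` on the chord from `1 - p` to `1`, at the point `1 - x`.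
  have hc := Real.strictConvexOn_mul_log.2 (show 1 - p ∈ Set.Ici 0 by simpa using hp1)
    (show (1 : ℝ) ∈ Set.Ici 0 by simp) (by linarith) (show 0 < x / p by positivity)
    (show 0 < 1 - x / p by rw [sub_pos, div_lt_one hp]; exact hxp) (by ring)
  have e : x / p * (1 - p) + (1 - x / p) * 1 = 1 - x := by field_simp; ring
  simp only [smul_eq_mul] at hc
  rw [e] at hc
  simp only [Real.log_one, mul_zero, add_zero] at hc
  -- This bound of one bit is the source of the `+ 1` in the theorem.
  have hb := Real.binEntropy_le_log_two (p := x)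
  rw [Real.binEntropy_eq_negMulLog_add_negMulLog_one_sub, Real.negMulLog, Real.negMulLog] at hb
  have h1 : 0 < Real.log 2 + x * Real.log x + x / p * ((1 - p) * Real.log (1 - p)) := by linarith
  have h2 : 0 < p / x * (Real.log 2 + x * Real.log x + x / p * ((1 - p) * Real.log (1 - p))) := by
    positivity
  have e2 : p / x * (Real.log 2 + x * Real.log x + x / p * ((1 - p) * Real.log (1 - p)))
      = p * (Real.log 2 / x) + p * Real.log x + (1 - p) * Real.log (1 - p) := by
    field_simp
  linarith

/-! ### Functional calculus of Hermitian matrices -/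

variable {n : Type*} [Fintype n]

theorem projection_posSemidef {P : Matrix n n ℂ} (hP : P.IsHermitian) (hPP : P * P = P) :
    P.PosSemidef := by
  have := posSemidef_conjTranspose_mul_self P
  rwa [hP.eq, hPP] at this

variable [DecidableEq n]

theorem continuousOn_real_spectrum (A : Matrix n n ℂ) (f : ℝ → ℝ) :
    ContinuousOn f (spectrum ℝ A) :=
  A.finite_real_spectrum.continuousOn f

theorem cfc_isHermitian (f : ℝ → ℝ) (A : Matrix n n ℂ) : (cfc f A).IsHermitian :=
  cfc_predicate f A

theorem cfc_mul_cfc (f g : ℝ → ℝ) (A : Matrix n n ℂ) :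
    cfc f A * cfc g A = cfc (fun x => f x * g x) A :=
  (cfc_mul f g A (continuousOn_real_spectrum A f) (continuousOn_real_spectrum A g)).symm

theorem cfc_sub_cfc (f g : ℝ → ℝ) (A : Matrix n n ℂ) :
    cfc f A - cfc g A = cfc (fun x => f x - g x) A :=
  (cfc_sub f g A (continuousOn_real_spectrum A f) (continuousOn_real_spectrum A g)).symm

theorem cfc_eq_conj {A : Matrix n n ℂ} (hA : A.IsHermitian) (f : ℝ → ℝ) :
    cfc f A = (hA.eigenvectorUnitary : Matrix n n ℂ)
      * diagonal (fun i => (f (hA.eigenvalues i) : ℂ))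
      * (hA.eigenvectorUnitary : Matrix n n ℂ)ᴴ := by
  rw [hA.cfc_eq, Matrix.IsHermitian.cfc, Unitary.conjStarAlgAut_apply]
  rfl

theorem cfc_id_of_isHermitian {A : Matrix n n ℂ} (hA : A.IsHermitian) :
    cfc (fun x : ℝ => x) A = A :=
  cfc_id' ℝ A hA.isSelfAdjoint

theorem cfc_congr_eigenvalues {A : Matrix n n ℂ} (hA : A.IsHermitian) {f g : ℝ → ℝ}
    (h : ∀ i, f (hA.eigenvalues i) = g (hA.eigenvalues i)) : cfc f A = cfc g A := by
  rw [cfc_eq_conj hA, cfc_eq_conj hA]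
  simp only [h]

theorem cfc_posSemidef {A : Matrix n n ℂ} (hA : A.IsHermitian) {f : ℝ → ℝ}
    (h : ∀ i, 0 ≤ f (hA.eigenvalues i)) : (cfc f A).PosSemidef := by
  rw [cfc_eq_conj hA]
  refine (PosSemidef.diagonal fun i => ?_).mul_mul_conjTranspose_same _
  simpa using h i

theorem eigenvectorUnitary_mul_conjTranspose {A : Matrix n n ℂ} (hA : A.IsHermitian) :
    (hA.eigenvectorUnitary : Matrix n n ℂ) * (hA.eigenvectorUnitary : Matrix n n ℂ)ᴴ = 1 :=
  Unitary.coe_mul_star_self hA.eigenvectorUnitary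

theorem eq_conj_diagonal {A : Matrix n n ℂ} (hA : A.IsHermitian) :
    A = (hA.eigenvectorUnitary : Matrix n n ℂ)
      * diagonal (fun i => (hA.eigenvalues i : ℂ)) * (hA.eigenvectorUnitary : Matrix n n ℂ)ᴴ := by
  rw [← cfc_eq_conj hA (fun x => x), cfc_id_of_isHermitian hA]

/-! ### Overlaps of two eigenbases -/

/-- The change of basis between the eigenbases of two Hermitian matrices. -/
noncomputable def overlap {A B : Matrix n n ℂ} (hA : A.IsHermitian) (hB : B.IsHermitian) :
    Matrix n n ℂ :=
  (hA.eigenvectorUnitary : Matrix n n ℂ)ᴴ * (hB.eigenvectorUnitary : Matrix n n ℂ)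

theorem trace_diagonal_mul_diagonal_mul (d e : n → ℂ) (Y Z : Matrix n n ℂ) :
    (diagonal d * Y * diagonal e * Zᴴ).trace
      = ∑ k : n × n, d k.1 * e k.2 * (Y k.1 k.2 * star (Z k.1 k.2)) := by
  rw [Fintype.sum_prod_type]
  simp only [trace, diag, mul_apply (M := diagonal d * Y * diagonal e), mul_diagonal, diagonal_mul,
    conjTranspose_apply]
  exact Finset.sum_congr rfl fun i _ => Finset.sum_congr rfl fun j _ => by ring

/-- Diagonalising each factor in its own eigenbasis makes the trace a classical double sum, even
when `A` and `B` do not commute. -/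
theorem trace_cfc_mul_cfc {A B : Matrix n n ℂ} (hA : A.IsHermitian) (hB : B.IsHermitian)
    (f g : ℝ → ℝ) :
    (cfc f A * cfc g B).trace.re = ∑ k : n × n, Complex.normSq (overlap hA hB k.1 k.2)
      * (f (hA.eigenvalues k.1) * g (hB.eigenvalues k.2)) := by
  have : (cfc f A * cfc g B).trace = (diagonal (fun i => (f (hA.eigenvalues i) : ℂ))
      * overlap hA hB * diagonal (fun i => (g (hB.eigenvalues i) : ℂ)) * (overlap hA hB)ᴴ).trace := by
    rw [cfc_eq_conj hA, cfc_eq_conj hB, overlap, conjTranspose_mul, conjTranspose_conjTranspose]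
    simp only [Matrix.mul_assoc]
    rw [Matrix.trace_mul_comm]
    simp only [Matrix.mul_assoc]
  rw [this, trace_diagonal_mul_diagonal_mul, Complex.re_sum]
  refine Finset.sum_congr rfl fun k _ => ?_
  rw [Complex.star_def, Complex.mul_conj]
  norm_cast
  ring

theorem sum_overlap_mul_left {A B : Matrix n n ℂ} (hA : A.IsHermitian) (hB : B.IsHermitian) :
    ∑ k : n × n, Complex.normSq (overlap hA hB k.1 k.2) * hA.eigenvalues k.1 = A.trace.re := by
  have := trace_cfc_mul_cfc hA hB (fun x => x) (fun _ => 1)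
  rw [cfc_id_of_isHermitian hA, cfc_const_one ℝ B hB.isSelfAdjoint, Matrix.mul_one] at this
  simpa using this.symm

theorem sum_overlap_mul_right {A B : Matrix n n ℂ} (hA : A.IsHermitian) (hB : B.IsHermitian) :
    ∑ k : n × n, Complex.normSq (overlap hA hB k.1 k.2) * hB.eigenvalues k.2 = B.trace.re := by
  have := trace_cfc_mul_cfc hA hB (fun _ => 1) (fun x => x)
  rw [cfc_id_of_isHermitian hB, cfc_const_one ℝ A hA.isSelfAdjoint, Matrix.one_mul] at this
  simpa using this.symm

/-- The vector `A u_i = λ_i u_i` lies in the range of `B`, which is orthogonal to every kernel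
vector `v_j` of `B`. -/
theorem overlap_mul_eigenvalues_eq_zero {A B : Matrix n n ℂ} (hA : A.IsHermitian)
    (hB : B.IsHermitian) (h : LinearMap.range A.mulVecLin ≤ LinearMap.range B.mulVecLin)
    {i j : n} (hj : hB.eigenvalues j = 0) :
    Complex.normSq (overlap hA hB i j) * hA.eigenvalues i = 0 := by
  obtain ⟨y, hy⟩ := h (LinearMap.mem_range_self A.mulVecLin
    ((hA.eigenvectorUnitary : Matrix n n ℂ).col i))
  simp only [mulVecLin_apply] at hy
  have hBv : star ((hB.eigenvectorUnitary : Matrix n n ℂ).col j) ᵥ* B = 0 := by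
    have := hB.mulVec_eigenvectorBasis j
    rw [hj, zero_smul] at this
    have h2 := congrArg star this
    rw [star_mulVec, hB.eq, star_zero] at h2
    rwa [hB.eigenvectorUnitary_col_eq]
  have hAv : A *ᵥ ((hA.eigenvectorUnitary : Matrix n n ℂ).col i)
      = (hA.eigenvalues i : ℂ) • ((hA.eigenvectorUnitary : Matrix n n ℂ).col i) := by
    rw [hA.eigenvectorUnitary_col_eq]
    exact hA.mulVec_eigenvectorBasis i
  have h0 : star ((hB.eigenvectorUnitary : Matrix n n ℂ).col j) ⬝ᵥ
      ((hA.eigenvalues i : ℂ) • ((hA.eigenvectorUnitary : Matrix n n ℂ).col i)) = 0 := by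
    rw [← hAv, ← hy, dotProduct_mulVec, hBv, zero_dotProduct]
  rw [dotProduct_smul, smul_eq_mul, mul_eq_zero] at h0
  rcases h0 with h0 | h0
  · rw [Complex.ofReal_eq_zero.1 h0, mul_zero]
  · have e : star (overlap hA hB i j) = star ((hB.eigenvectorUnitary : Matrix n n ℂ).col j) ⬝ᵥ
        (hA.eigenvectorUnitary : Matrix n n ℂ).col i := by
      rw [← conjTranspose_apply, overlap, conjTranspose_mul, conjTranspose_conjTranspose]
      rfl
    rw [h0, star_eq_zero] at e
    rw [e, map_zero, zero_mul]

/-- With the matrix `Y` of `X` taken between the two eigenbases, the left side splits into one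
scalar quadratic form per entry, and `two_mul_re_sub_le` bounds each. -/
theorem variational_le_sum_overlap {A B X : Matrix n n ℂ} (hA : A.PosSemidef) (hB : B.PosSemidef)
    (hX : X.IsHermitian) {s : ℝ} (hs : 0 < s) :
    2 * (A * X).trace.re - (X * B * X).trace.re - s * (X * A * X).trace.re
      ≤ ∑ k : n × n, Complex.normSq (overlap hA.1 hB.1 k.1 k.2) * (hA.1.eigenvalues k.1 ^ 2
        / (hB.1.eigenvalues k.2 + s * hA.1.eigenvalues k.1)) := by
  set U := (hA.1.eigenvectorUnitary : Matrix n n ℂ) with hU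
  set V := (hB.1.eigenvectorUnitary : Matrix n n ℂ) with hV
  have hUU : U * Uᴴ = 1 := eigenvectorUnitary_mul_conjTranspose hA.1
  have hVV : V * Vᴴ = 1 := eigenvectorUnitary_mul_conjTranspose hB.1
  set Y := Uᴴ * X * V with hY
  have hYs : Yᴴ = Vᴴ * X * U := by
    rw [hY, conjTranspose_mul, conjTranspose_mul, conjTranspose_conjTranspose, hX.eq,
      Matrix.mul_assoc]
  have e1 : (A * X).trace = (diagonal (fun i => (hA.1.eigenvalues i : ℂ)) * overlap hA.1 hB.1
      * diagonal (fun _ => 1) * Yᴴ).trace := by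
    conv_lhs => rw [eq_conj_diagonal hA.1]
    rw [hYs, overlap, diagonal_one, Matrix.mul_one, ← hU, ← hV]
    have : ∀ D : Matrix n n ℂ, D * (Uᴴ * V) * (Vᴴ * X * U) = D * Uᴴ * (V * Vᴴ) * X * U := by
      intro D; simp only [Matrix.mul_assoc]
    rw [this, hVV, Matrix.mul_one, Matrix.mul_assoc U, Matrix.mul_assoc U, Matrix.trace_mul_comm U]
  have e2 : (X * B * X).trace = (diagonal (fun _ => 1) * Y
      * diagonal (fun i => (hB.1.eigenvalues i : ℂ)) * Yᴴ).trace := by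
    conv_lhs => rw [eq_conj_diagonal hB.1]
    rw [hYs, hY, diagonal_one, Matrix.one_mul, ← hV]
    have : ∀ D : Matrix n n ℂ, Uᴴ * X * V * D * (Vᴴ * X * U) = Uᴴ * (X * (V * D * Vᴴ) * X * U) := by
      intro D; simp only [Matrix.mul_assoc]
    rw [this, Matrix.trace_mul_comm Uᴴ, Matrix.mul_assoc _ U, hUU, Matrix.mul_one]
  have e3 : (X * A * X).trace = (diagonal (fun i => (hA.1.eigenvalues i : ℂ)) * Y
      * diagonal (fun _ => 1) * Yᴴ).trace := by
    conv_lhs => rw [eq_conj_diagonal hA.1]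
    rw [hYs, hY, diagonal_one, Matrix.mul_one, ← hU]
    have : ∀ D : Matrix n n ℂ, D * (Uᴴ * X * V) * (Vᴴ * X * U)
        = D * Uᴴ * X * (V * Vᴴ) * X * U := by
      intro D; simp only [Matrix.mul_assoc]
    rw [this, hVV, Matrix.mul_one, Matrix.trace_mul_comm _ U, Matrix.mul_assoc X,
      Matrix.trace_mul_comm X]
    simp only [Matrix.mul_assoc]
  rw [e1, e2, e3, trace_diagonal_mul_diagonal_mul, trace_diagonal_mul_diagonal_mul,
    trace_diagonal_mul_diagonal_mul, Complex.re_sum, Complex.re_sum, Complex.re_sum,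
    Finset.mul_sum, Finset.mul_sum, ← Finset.sum_sub_distrib, ← Finset.sum_sub_distrib]
  refine Finset.sum_le_sum fun k _ => ?_
  have := two_mul_re_sub_le (overlap hA.1 hB.1 k.1 k.2) (Y k.1 k.2) (hA.eigenvalues_nonneg k.1)
    (hB.eigenvalues_nonneg k.2) hs
  have hn : Y k.1 k.2 * star (Y k.1 k.2) = (Complex.normSq (Y k.1 k.2) : ℂ) := Complex.mul_conj _
  rw [mul_one, one_mul, Complex.re_ofReal_mul, hn, ← Complex.ofReal_mul, ← Complex.ofReal_mul,
    Complex.ofReal_re, Complex.ofReal_re]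
  exact this

/-! ### Two-outcome measurements and data processing -/

theorem trace_mul_nonneg {A B : Matrix n n ℂ} (hA : A.PosSemidef) (hB : B.PosSemidef) :
    0 ≤ (A * B).trace.re := by
  have := trace_cfc_mul_cfc hA.1 hB.1 (fun x => x) (fun x => x)
  rw [cfc_id_of_isHermitian hA.1, cfc_id_of_isHermitian hB.1] at this
  rw [this]
  exact Finset.sum_nonneg fun k _ => mul_nonneg (Complex.normSq_nonneg _)
    (mul_nonneg (hA.eigenvalues_nonneg _) (hB.eigenvalues_nonneg _))

theorem one_sub_projection_posSemidef {P : Matrix n n ℂ} (hP : P.IsHermitian) (hPP : P * P = P) :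
    (1 - P).PosSemidef :=
  projection_posSemidef (isHermitian_one.sub hP) (by
    simp [Matrix.mul_sub, Matrix.sub_mul, hPP])

theorem trace_sandwich_projection {P : Matrix n n ℂ} (hPP : P * P = P) (A : Matrix n n ℂ)
    (a b : ℝ) :
    (((a • P + b • (1 - P)) * A * (a • P + b • (1 - P))).trace.re
      = a ^ 2 * (A * P).trace.re + b ^ 2 * (A.trace.re - (A * P).trace.re)) := by
  have h : (a • P + b • (1 - P)) * (a • P + b • (1 - P)) = (a ^ 2) • P + (b ^ 2) • (1 - P) := by
    have h1 : P * (1 - P) = 0 := by rw [Matrix.mul_sub, hPP]; simp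
    have h2 : (1 - P) * P = 0 := by rw [Matrix.sub_mul, hPP]; simp
    have h3 : (1 - P) * (1 - P) = 1 - P := by rw [Matrix.mul_sub, h2]; simp
    simp only [Matrix.mul_add, Matrix.add_mul, smul_mul_assoc, mul_smul_comm, h1, h2, h3, hPP,
      smul_zero, add_zero, zero_add, smul_smul, sq]
  rw [Matrix.trace_mul_comm, ← Matrix.mul_assoc, h, Matrix.trace_mul_comm, Matrix.mul_add,
    mul_smul_comm, mul_smul_comm, Matrix.mul_sub, Matrix.mul_one]
  simp only [trace_add, trace_smul, trace_sub, Complex.add_re, Complex.smul_re, Complex.sub_re,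
    smul_eq_mul]

/-- Data processing for the relative entropy under a two-outcome projective measurement, with the
second outcome of `σ` bounded trivially. -/
theorem binary_le_relEntropy {ρ σ P : Matrix n n ℂ} (hρ : IsState ρ) (hσ : IsState σ)
    (hsupp : LinearMap.range ρ.mulVecLin ≤ LinearMap.range σ.mulVecLin)
    (hP : P.IsHermitian) (hPP : P * P = P) {b : ℝ} (hb : 0 < b) (hσb : (σ * P).trace.re ≤ b) :
    (ρ * P).trace.re * Real.log (ρ * P).trace.re
      + (1 - (ρ * P).trace.re) * Real.log (1 - (ρ * P).trace.re)
      - (ρ * P).trace.re * Real.log b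
      ≤ Real.log 2 * (ρ * (mlog ρ - mlog σ)).trace.re := by
  have hP0 := projection_posSemidef hP hPP
  have hP1 := one_sub_projection_posSemidef hP hPP
  set a := (ρ * P).trace.re with ha
  have ha0 : 0 ≤ a := trace_mul_nonneg hρ.1 hP0
  have hσ0 : 0 ≤ (σ * P).trace.re := trace_mul_nonneg hσ.1 hP0
  have hρ1 : ρ.trace.re = 1 := by rw [hρ.2]; rfl
  have hσ1 : σ.trace.re = 1 := by rw [hσ.2]; rfl
  have ha1 : a ≤ 1 := by
    have := trace_mul_nonneg hρ.1 hP1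
    rw [Matrix.mul_sub, Matrix.mul_one, trace_sub, Complex.sub_re, hρ1] at this
    linarith
  have hD : Real.log 2 * (ρ * (mlog ρ - mlog σ)).trace.re
      = ∑ k : n × n, Complex.normSq (overlap hρ.1.1 hσ.1.1 k.1 k.2) * hρ.1.1.eigenvalues k.1
        * (Real.log (hρ.1.1.eigenvalues k.1) - Real.log (hσ.1.1.eigenvalues k.2)) := by
    have hl : Real.log 2 ≠ 0 := (Real.log_pos one_lt_two).ne'
    have h1 : (ρ * mlog ρ).trace.re = ∑ k : n × n,
        Complex.normSq (overlap hρ.1.1 hσ.1.1 k.1 k.2) * (hρ.1.1.eigenvalues k.1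
          * Real.logb 2 (hρ.1.1.eigenvalues k.1)) := by
      have := trace_cfc_mul_cfc hρ.1.1 hσ.1.1 (fun x => x * Real.logb 2 x) (fun _ => 1)
      rw [← cfc_mul_cfc, cfc_id_of_isHermitian hρ.1.1, cfc_const_one ℝ σ hσ.1.1.isSelfAdjoint,
        Matrix.mul_one] at this
      rw [mlog]
      simpa only [mul_one] using this
    have h2 := trace_cfc_mul_cfc hρ.1.1 hσ.1.1 (fun x => x) (Real.logb 2)
    rw [cfc_id_of_isHermitian hρ.1.1] at h2
    rw [Matrix.mul_sub, trace_sub, Complex.sub_re, h1, mlog, h2, ← Finset.sum_sub_distrib,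
      Finset.mul_sum]
    refine Finset.sum_congr rfl fun k _ => ?_
    simp only [Real.logb]
    field_simp
  rw [hD]
  refine binary_le_sum_mul_log (fun k : n × n => Complex.normSq (overlap hρ.1.1 hσ.1.1 k.1 k.2))
    (fun k => hρ.1.1.eigenvalues k.1) (fun k => hσ.1.1.eigenvalues k.2)
    (fun k => Complex.normSq_nonneg _) (fun k => hρ.1.eigenvalues_nonneg _)
    (fun k => hσ.1.eigenvalues_nonneg _)
    (fun k hk => overlap_mul_eigenvalues_eq_zero _ _ hsupp hk)
    ((sum_overlap_mul_left _ _).trans hρ1) ((sum_overlap_mul_right _ _).trans hσ1) ha0 ha1 hb ?_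
  intro s hs
  have h1a : 0 ≤ 1 - a := by linarith
  have hd1 : 0 < b + s * a := by positivity
  have hd2 : 0 < 1 + s * (1 - a) := by positivity
  -- `c` and `d` maximise the quadratics `2 c a - c² (b + s a)` and `2 d (1 - a) - d² (1 + s (1 -
  -- a))`, whose maxima are the two terms wanted.
  set c := a / (b + s * a) with hc
  set d := (1 - a) / (1 + s * (1 - a)) with hd
  have hX : (c • P + d • (1 - P)).IsHermitian :=
    (hP.smul (by simp [IsSelfAdjoint])).add ((isHermitian_one.sub hP).smul (by simp [IsSelfAdjoint]))
  have hv := variational_le_sum_overlap hρ.1 hσ.1 hX hs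
  rw [trace_sandwich_projection hPP, trace_sandwich_projection hPP, hρ1, hσ1, ← ha] at hv
  have e : (ρ * (c • P + d • (1 - P))).trace.re = c * a + d * (1 - a) := by
    rw [Matrix.mul_add, mul_smul_comm, mul_smul_comm, Matrix.mul_sub, Matrix.mul_one]
    simp [hρ1, ha]
  rw [e] at hv
  refine le_trans ?_ hv
  -- The weights of `σ` enter with a negative sign, so upper bounds on them suffice.
  have i1 : c ^ 2 * (σ * P).trace.re ≤ c ^ 2 * b := by gcongr
  have i2 : d ^ 2 * (1 - (σ * P).trace.re) ≤ d ^ 2 * 1 := by gcongr; linarith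
  have j1 : a ^ 2 / (b + s * a) = 2 * (c * a) - c ^ 2 * b - s * (c ^ 2 * a) := by
    rw [hc]; field_simp; ring
  have j2 : (1 - a) ^ 2 / (1 + s * (1 - a))
      = 2 * (d * (1 - a)) - d ^ 2 * 1 - s * (d ^ 2 * (1 - a)) := by
    rw [hd]; field_simp; ring
  linarith

end

section

variable {n : Type*} [Fintype n]

theorem re_trace_conjTranspose (A : Matrix n n ℂ) : Aᴴ.trace.re = A.trace.re := by
  rw [trace_conjTranspose]
  exact Complex.conj_re _

/-- Cauchy-Schwarz for the Hilbert-Schmidt inner product. -/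
theorem re_trace_conjTranspose_mul_le (Y Z : Matrix n n ℂ) :
    (Yᴴ * Z).trace.re ≤ Real.sqrt (Yᴴ * Y).trace.re * Real.sqrt (Zᴴ * Z).trace.re := by
  have h : ∀ Y Z : Matrix n n ℂ, (Yᴴ * Z).trace.re
      = ∑ k : n × n, (star (Y k.2 k.1) * Z k.2 k.1).re := by
    intro Y Z
    rw [Fintype.sum_prod_type]
    simp only [trace, diag, mul_apply, conjTranspose_apply, Complex.re_sum]
  have h2 : ∀ Y : Matrix n n ℂ, (Yᴴ * Y).trace.re = ∑ k : n × n, ‖Y k.2 k.1‖ ^ 2 := by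
    intro Y
    rw [h]
    refine Finset.sum_congr rfl fun k _ => ?_
    have hn : star (Y k.2 k.1) * Y k.2 k.1 = (Complex.normSq (Y k.2 k.1) : ℂ) :=
      (Complex.normSq_eq_conj_mul_self).symm
    rw [hn, Complex.ofReal_re, Complex.normSq_eq_norm_sq]
  rw [h, h2, h2]
  refine le_trans (Finset.sum_le_sum fun k _ => ?_)
    (Real.sum_mul_le_sqrt_mul_sqrt Finset.univ (fun k : n × n => ‖Y k.2 k.1‖)
      (fun k : n × n => ‖Z k.2 k.1‖))
  refine (Complex.re_le_norm _).trans ?_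
  rw [norm_mul, norm_star]

variable [DecidableEq n]

/-! ### Supports and the polar decomposition -/

/-- The orthogonal projection onto the support of a Hermitian matrix. -/
noncomputable def suppProj (A : Matrix n n ℂ) : Matrix n n ℂ :=
  cfc (fun x : ℝ => x⁻¹ * x) A

theorem suppProj_isHermitian (A : Matrix n n ℂ) : (suppProj A).IsHermitian :=
  cfc_isHermitian _ A

theorem suppProj_mul_self (A : Matrix n n ℂ) : suppProj A * suppProj A = suppProj A := by
  rw [suppProj, cfc_mul_cfc]
  congr 1
  funext x
  rcases eq_or_ne x 0 with rfl | h
  · simp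
  · simp [h]

theorem suppProj_eq {A : Matrix n n ℂ} (hA : A.IsHermitian) :
    suppProj A = cfc (fun x : ℝ => x⁻¹) A * A := by
  conv_rhs => arg 2; rw [← cfc_id_of_isHermitian hA]
  rw [cfc_mul_cfc, suppProj]

theorem mul_suppProj_self {A : Matrix n n ℂ} (hA : A.IsHermitian) : A * suppProj A = A := by
  have h : cfc (fun x : ℝ => x) A * suppProj A = cfc (fun x : ℝ => x) A := by
    rw [suppProj, cfc_mul_cfc]
    congr 1
    funext x
    rcases eq_or_ne x 0 with rfl | h
    · simp
    · simp [h]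
  rwa [cfc_id_of_isHermitian hA] at h

/-- Compressing `B - Nᴴ N` to the kernel of `B` leaves `-Zᴴ Z`; positivity forces `Z = 0`. -/
theorem mul_suppProj_of_le {B N : Matrix n n ℂ} (hB : B.IsHermitian)
    (h : (B - Nᴴ * N).PosSemidef) : N * suppProj B = N := by
  set Z := N * (1 - suppProj B) with hZ
  have h0 : B * (1 - suppProj B) = 0 := by rw [Matrix.mul_sub, mul_suppProj_self hB]; simp
  have h1 := h.conjTranspose_mul_mul_same (1 - suppProj B)
  have h2 : (1 - suppProj B)ᴴ * (B - Nᴴ * N) * (1 - suppProj B) = -(Zᴴ * Z) := by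
    rw [Matrix.mul_assoc, Matrix.sub_mul, h0, hZ, conjTranspose_mul]
    simp only [zero_sub, Matrix.mul_neg, Matrix.mul_assoc]
  rw [h2] at h1
  have h3 := h1.trace_nonneg
  rw [trace_neg] at h3
  have h4 := (posSemidef_conjTranspose_mul_self Z).trace_nonneg
  have h5 := trace_conjTranspose_mul_self_eq_zero_iff.1 (le_antisymm (neg_nonneg.1 h3) h4)
  rw [hZ, Matrix.mul_sub, Matrix.mul_one, sub_eq_zero] at h5
  exact h5.symm

theorem msqrt_isHermitian (A : Matrix n n ℂ) : (msqrt A).IsHermitian :=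
  cfc_isHermitian _ A

theorem msqrt_posSemidef {A : Matrix n n ℂ} (hA : A.IsHermitian) : (msqrt A).PosSemidef :=
  cfc_posSemidef hA fun _ => Real.sqrt_nonneg _

theorem msqrt_mul_msqrt {A : Matrix n n ℂ} (hA : A.PosSemidef) : msqrt A * msqrt A = A := by
  rw [msqrt, cfc_mul_cfc]
  conv_rhs => rw [← cfc_id_of_isHermitian hA.1]
  exact cfc_congr_eigenvalues hA.1 fun i => Real.mul_self_sqrt (hA.eigenvalues_nonneg i)

/-- The pseudo-inverse of the square root. -/
noncomputable def msqrtInv (A : Matrix n n ℂ) : Matrix n n ℂ :=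
  cfc (fun x : ℝ => (Real.sqrt x)⁻¹) A

theorem msqrtInv_isHermitian (A : Matrix n n ℂ) : (msqrtInv A).IsHermitian :=
  cfc_isHermitian _ A

theorem inv_sqrt_mul_sqrt {x : ℝ} (hx : 0 ≤ x) : (Real.sqrt x)⁻¹ * Real.sqrt x = x⁻¹ * x := by
  rcases hx.eq_or_lt with rfl | h
  · simp
  · rw [inv_mul_cancel₀ (Real.sqrt_pos.2 h).ne', inv_mul_cancel₀ h.ne']

theorem msqrtInv_mul_msqrt {A : Matrix n n ℂ} (hA : A.PosSemidef) :
    msqrtInv A * msqrt A = suppProj A := by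
  rw [msqrt, msqrtInv, cfc_mul_cfc, suppProj]
  exact cfc_congr_eigenvalues hA.1 fun i => inv_sqrt_mul_sqrt (hA.eigenvalues_nonneg i)

theorem msqrt_mul_msqrtInv {A : Matrix n n ℂ} (hA : A.PosSemidef) :
    msqrt A * msqrtInv A = suppProj A := by
  rw [msqrt, msqrtInv, cfc_mul_cfc, suppProj]
  exact cfc_congr_eigenvalues hA.1 fun i => by
    rw [mul_comm]; exact inv_sqrt_mul_sqrt (hA.eigenvalues_nonneg i)

theorem msqrtInv_mul_self {A : Matrix n n ℂ} (hA : A.PosSemidef) :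
    msqrtInv A * A = msqrt A := by
  conv_lhs => arg 2; rw [← msqrt_mul_msqrt hA]
  rw [← Matrix.mul_assoc, msqrtInv_mul_msqrt hA, msqrt, suppProj, cfc_mul_cfc]
  refine cfc_congr_eigenvalues hA.1 fun i => ?_
  rcases eq_or_ne (hA.1.eigenvalues i) 0 with h | h
  · simp [h]
  · simp [h]

theorem msqrtInv_mul_suppProj {A : Matrix n n ℂ} (hA : A.PosSemidef) :
    msqrtInv A * suppProj A = msqrtInv A := by
  rw [msqrtInv, suppProj, cfc_mul_cfc]
  refine cfc_congr_eigenvalues hA.1 fun i => ?_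
  rcases eq_or_ne (hA.1.eigenvalues i) 0 with h | h
  · simp [h]
  · simp [h]

/-- With the pseudo-inverse root, `W = N (Nᴴ N)^(-1/2)` is a partial isometry, in general not
unitary; being contractive on both sides is all that is used later. -/
theorem polar_decomposition (N : Matrix n n ℂ) :
    ∃ W : Matrix n n ℂ, W * msqrt (Nᴴ * N) = N ∧ Wᴴ * N = msqrt (Nᴴ * N) ∧
      (1 - Wᴴ * W).PosSemidef ∧ (1 - W * Wᴴ).PosSemidef := by
  have hH := posSemidef_conjTranspose_mul_self N
  have hW : (N * msqrtInv (Nᴴ * N))ᴴ * (N * msqrtInv (Nᴴ * N)) = suppProj (Nᴴ * N) := by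
    rw [conjTranspose_mul, (msqrtInv_isHermitian _).eq, Matrix.mul_assoc,
      ← Matrix.mul_assoc Nᴴ, ← Matrix.mul_assoc, msqrtInv_mul_self hH, msqrt_mul_msqrtInv hH]
  refine ⟨N * msqrtInv (Nᴴ * N), ?_, ?_, ?_, ?_⟩
  · rw [Matrix.mul_assoc, msqrtInv_mul_msqrt hH]
    exact mul_suppProj_of_le hH.1 (by rw [sub_self]; exact PosSemidef.zero)
  · rw [conjTranspose_mul, (msqrtInv_isHermitian _).eq, Matrix.mul_assoc, msqrtInv_mul_self hH]
  · rw [hW]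
    exact one_sub_projection_posSemidef (suppProj_isHermitian _) (suppProj_mul_self _)
  · refine one_sub_projection_posSemidef (isHermitian_mul_conjTranspose_self _) ?_
    rw [Matrix.mul_assoc, ← Matrix.mul_assoc _ (N * _) (N * _)ᴴ, hW, ← Matrix.mul_assoc,
      Matrix.mul_assoc N, msqrtInv_mul_suppProj hH]

/-! ### Trace norm and fidelity -/

theorem trace_mul_mono {A B C : Matrix n n ℂ} (hA : A.PosSemidef) (h : (C - B).PosSemidef) :
    (A * B).trace.re ≤ (A * C).trace.re := by
  have := trace_mul_nonneg hA h
  rw [Matrix.mul_sub, trace_sub, Complex.sub_re] at this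
  linarith

/-- Pairing `M` with the positive operator `(1 - C)ᴴ (1 - C) + (1 - Cᴴ C) = 2 - C - Cᴴ` gives twice
the inequality. -/
theorem re_trace_mul_le_of_contraction {C M : Matrix n n ℂ} (hM : M.PosSemidef)
    (hC : (1 - Cᴴ * C).PosSemidef) : (C * M).trace.re ≤ M.trace.re := by
  have h := trace_mul_nonneg hM ((posSemidef_conjTranspose_mul_self (1 - C)).add hC)
  have e : (1 - C)ᴴ * (1 - C) + (1 - Cᴴ * C) = 1 - C - Cᴴ + 1 := by
    rw [conjTranspose_sub, conjTranspose_one]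
    simp only [Matrix.sub_mul, Matrix.mul_sub, Matrix.one_mul, Matrix.mul_one]
    abel
  have e1 : (M * Cᴴ).trace.re = (C * M).trace.re := by
    rw [← re_trace_conjTranspose (C * M), conjTranspose_mul, hM.1.eq]
  have e2 : (M * C).trace.re = (C * M).trace.re := by rw [Matrix.trace_mul_comm]
  rw [e] at h
  simp only [Matrix.mul_add, Matrix.mul_sub, Matrix.mul_one, trace_add, trace_sub, Complex.add_re,
    Complex.sub_re, e1, e2] at h
  linarith

/-- In `X = W |X|` the factor `W` is a contraction, hence so is `K W`. -/
theorem re_trace_mul_le_traceNorm {K : Matrix n n ℂ} (X : Matrix n n ℂ)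
    (hK : (1 - Kᴴ * K).PosSemidef) : (K * X).trace.re ≤ traceNorm X := by
  obtain ⟨W, hW, -, hWW, -⟩ := polar_decomposition X
  have hX := msqrt_posSemidef (posSemidef_conjTranspose_mul_self X).1
  conv_lhs => rw [← hW, ← Matrix.mul_assoc]
  refine re_trace_mul_le_of_contraction hX ?_
  have h := (hK.conjTranspose_mul_mul_same W).add hWW
  convert h using 1
  rw [conjTranspose_mul, Matrix.mul_sub, Matrix.mul_one, Matrix.sub_mul]
  simp only [Matrix.mul_assoc]
  abel

theorem traceNorm_nonneg (X : Matrix n n ℂ) : 0 ≤ traceNorm X :=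
  (Complex.nonneg_iff.1 (msqrt_posSemidef
    (posSemidef_conjTranspose_mul_self X).1).trace_nonneg).1

/-- This is the trace of `|H| + H = 2 H₊`. -/
theorem traceNorm_of_isHermitian {H : Matrix n n ℂ} (hH : H.IsHermitian) :
    traceNorm H = 2 * (H * cfc (fun x : ℝ => if 0 < x then 1 else 0) H).trace.re - H.trace.re := by
  have h1 : msqrt (Hᴴ * H) = cfc (fun x : ℝ => Real.sqrt (x * x)) H := by
    have : Hᴴ * H = cfc (fun x : ℝ => x * x) H := by
      rw [← cfc_mul_cfc, cfc_id_of_isHermitian hH, hH.eq]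
    rw [this, msqrt]
    exact (cfc_comp' Real.sqrt (fun x : ℝ => x * x) H Real.continuous_sqrt.continuousOn
      (continuousOn_real_spectrum _ _) hH.isSelfAdjoint).symm
  have h2 : msqrt (Hᴴ * H) + H
      = 2 • (H * cfc (fun x : ℝ => if 0 < x then 1 else 0) H) := by
    have e : H * cfc (fun x : ℝ => if 0 < x then 1 else 0) H
        = cfc (fun x : ℝ => x * if 0 < x then 1 else 0) H := by
      rw [← cfc_mul_cfc, cfc_id_of_isHermitian hH]
    rw [h1, e]
    conv_lhs => arg 2; rw [← cfc_id_of_isHermitian hH]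
    rw [two_smul, ← cfc_add (a := H) _ _ (continuousOn_real_spectrum _ _)
      (continuousOn_real_spectrum _ _), ← cfc_add (a := H) _ _ (continuousOn_real_spectrum _ _)
      (continuousOn_real_spectrum _ _)]
    refine cfc_congr_eigenvalues hH fun i => ?_
    rw [Real.sqrt_mul_self_eq_abs]
    split_ifs with h
    · rw [abs_of_pos h]; ring
    · rw [abs_of_nonpos (not_lt.1 h)]; ring
  have h3 := congrArg (fun M : Matrix n n ℂ => M.trace.re) h2
  simp only [trace_add, Complex.add_re, two_smul] at h3
  rw [traceNorm]
  linarith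

theorem indicator_cfc_mul_self (H : Matrix n n ℂ) :
    cfc (fun x : ℝ => if 0 < x then (1 : ℝ) else 0) H * cfc (fun x : ℝ => if 0 < x then 1 else 0) H
      = cfc (fun x : ℝ => if 0 < x then 1 else 0) H := by
  rw [cfc_mul_cfc]
  congr 1
  funext x
  split_ifs <;> simp

/-- The fidelity does not exceed that of the outcome distributions of a projective measurement. -/
theorem traceNorm_msqrt_mul_le {ρ τ P : Matrix n n ℂ} (hρ : IsState ρ) (hτ : IsState τ)
    (hP : P.IsHermitian) (hPP : P * P = P) :
    traceNorm (msqrt ρ * msqrt τ) ≤ Real.sqrt (ρ * P).trace.re * Real.sqrt (τ * P).trace.re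
      + Real.sqrt (1 - (ρ * P).trace.re) * Real.sqrt (1 - (τ * P).trace.re) := by
  obtain ⟨W, -, hW, -, hWW⟩ := polar_decomposition (msqrt ρ * msqrt τ)
  -- Cauchy-Schwarz for `E √ρ W` and `E √τ`; then `W Wᴴ ≤ 1` removes `W`. The cases `E = P` and `E =
  -- 1 - P` add up to the trace norm.
  have key : ∀ E : Matrix n n ℂ, E.IsHermitian → E * E = E →
      (Wᴴ * (msqrt ρ * E * msqrt τ)).trace.re
        ≤ Real.sqrt (ρ * E).trace.re * Real.sqrt (τ * E).trace.re := by
    intro E hE hEE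
    have h := re_trace_conjTranspose_mul_le (E * msqrt ρ * W) (E * msqrt τ)
    have e1 : (E * msqrt ρ * W)ᴴ * (E * msqrt τ) = Wᴴ * (msqrt ρ * E * msqrt τ) := by
      rw [conjTranspose_mul, conjTranspose_mul, hE.eq, (msqrt_isHermitian ρ).eq]
      simp only [Matrix.mul_assoc]
      rw [← Matrix.mul_assoc E E, hEE]
    have e2 : ∀ τ : Matrix n n ℂ, IsState τ →
        ((E * msqrt τ)ᴴ * (E * msqrt τ)).trace.re = (τ * E).trace.re := by
      intro τ hτ
      rw [conjTranspose_mul, hE.eq, (msqrt_isHermitian τ).eq, Matrix.trace_mul_comm,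
        Matrix.mul_assoc, ← Matrix.mul_assoc (msqrt τ), msqrt_mul_msqrt hτ.1,
        Matrix.trace_mul_comm, Matrix.mul_assoc, hEE]
    have e3 : ((E * msqrt ρ * W)ᴴ * (E * msqrt ρ * W)).trace.re ≤ (ρ * E).trace.re := by
      rw [← e2 ρ hρ, conjTranspose_mul (E * msqrt ρ) W, Matrix.mul_assoc, Matrix.trace_mul_comm]
      have := trace_mul_mono (posSemidef_conjTranspose_mul_self (E * msqrt ρ)) hWW
      rw [Matrix.mul_one] at this
      convert this using 3
      simp only [Matrix.mul_assoc]
    rw [e1, e2 τ hτ] at h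
    exact h.trans (by gcongr)
  have h1 := key P hP hPP
  have h2 := key (1 - P) (isHermitian_one.sub hP) (by simp [Matrix.mul_sub, Matrix.sub_mul, hPP])
  have hρ1 : ρ.trace.re = 1 := by rw [hρ.2]; rfl
  have hτ1 : τ.trace.re = 1 := by rw [hτ.2]; rfl
  have e : traceNorm (msqrt ρ * msqrt τ) = (Wᴴ * (msqrt ρ * P * msqrt τ)).trace.re
      + (Wᴴ * (msqrt ρ * (1 - P) * msqrt τ)).trace.re := by
    rw [← Complex.add_re, ← trace_add, ← Matrix.mul_add, ← Matrix.add_mul, ← Matrix.mul_add,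
      add_sub_cancel, Matrix.mul_one, hW]
    rfl
  rw [e]
  refine (add_le_add h1 h2).trans (le_of_eq ?_)
  simp only [Matrix.mul_sub, Matrix.mul_one, trace_sub, Complex.sub_re, hρ1, hτ1]

/-- The cross term in the square of the bound on `f` is at most `p (1 - p) + q (1 - q)` by the
arithmetic-geometric mean inequality. -/
theorem sq_sub_add_sq_le_one {p q f : ℝ} (hp0 : 0 ≤ p) (hp1 : p ≤ 1) (hq0 : 0 ≤ q) (hq1 : q ≤ 1)
    (hf0 : 0 ≤ f)
    (hf : f ≤ Real.sqrt p * Real.sqrt q + Real.sqrt (1 - p) * Real.sqrt (1 - q)) :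
    (p - q) ^ 2 + f ^ 2 ≤ 1 := by
  have h := pow_le_pow_left₀ hf0 hf 2
  have a1 := Real.sq_sqrt hp0
  have a2 := Real.sq_sqrt hq0
  have a3 := Real.sq_sqrt (sub_nonneg.2 hp1)
  have a4 := Real.sq_sqrt (sub_nonneg.2 hq1)
  set a := Real.sqrt p
  set b := Real.sqrt q
  set c := Real.sqrt (1 - p)
  set d := Real.sqrt (1 - q)
  have h2 := sq_nonneg (a * c - b * d)
  have e1 : (a * b + c * d) ^ 2 = a ^ 2 * b ^ 2 + c ^ 2 * d ^ 2 + 2 * (a * c * (b * d)) := by ring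
  have e2 : (a * c - b * d) ^ 2 = a ^ 2 * c ^ 2 + b ^ 2 * d ^ 2 - 2 * (a * c * (b * d)) := by ring
  rw [e1, a1, a2, a3, a4] at h
  rw [e2, a1, a2, a3, a4] at h2
  nlinarith

/-- One of the Fuchs-van de Graaf inequalities. -/
theorem traceDist_le_purifiedDist {ρ τ : Matrix n n ℂ} (hρ : IsState ρ) (hτ : IsState τ) :
    traceDist ρ τ ≤ purifiedDist ρ τ := by
  have hH : (ρ - τ).IsHermitian := hρ.1.1.sub hτ.1.1
  -- The Helstrom projection, for which the trace distance is the difference of outcome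
  -- probabilities.
  set P := cfc (fun x : ℝ => if 0 < x then (1 : ℝ) else 0) (ρ - τ) with hPdef
  have hP : P.IsHermitian := cfc_isHermitian _ _
  have hPP : P * P = P := indicator_cfc_mul_self _
  have hP0 := projection_posSemidef hP hPP
  have hP1 := one_sub_projection_posSemidef hP hPP
  have hbd : ∀ τ : Matrix n n ℂ, IsState τ → 0 ≤ (τ * P).trace.re ∧ (τ * P).trace.re ≤ 1 := by
    intro τ hτ
    refine ⟨trace_mul_nonneg hτ.1 hP0, ?_⟩
    have := trace_mul_mono hτ.1 hP1
    rwa [Matrix.mul_one, hτ.2, Complex.one_re] at this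
  have hn : traceDist ρ τ = (ρ * P).trace.re - (τ * P).trace.re := by
    rw [traceDist, traceNorm_of_isHermitian hH, ← hPdef, Matrix.sub_mul, trace_sub, trace_sub,
      hρ.2, hτ.2]
    simp
  have := sq_sub_add_sq_le_one (hbd ρ hρ).1 (hbd ρ hρ).2 (hbd τ hτ).1 (hbd τ hτ).2
    (traceNorm_nonneg _) (traceNorm_msqrt_mul_le hρ hτ hP hPP)
  rw [hn, purifiedDist, fidelity]
  exact Real.le_sqrt_of_sq_le (by linarith)

end

section

/-! ### Upper bounds on the max-relative entropy -/

theorem Dmax_le_of_posSemidef {n : Type*} {ρ σ : Matrix n n ℂ} {l : ℝ} (hl : 0 < l)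
    (h : (l • σ - ρ).PosSemidef) : Dmax ρ σ ≤ ((Real.logb 2 l : ℝ) : EReal) := by
  have hi : (⨅ (m : ℝ≥0) (_ : ((m : ℝ) • σ - ρ).PosSemidef), (m : ℝ≥0∞)) ≤ ENNReal.ofReal l :=
    iInf₂_le l.toNNReal (by rwa [Real.coe_toNNReal l hl.le])
  rw [Dmax, elog2, Real.logb, EReal.coe_div, ← ENNReal.log_ofReal_of_pos hl]
  exact EReal.div_le_div_right_of_nonneg
    (by exact_mod_cast (Real.log_pos one_lt_two).le) (ENNReal.log_monotone hi)

variable {n : Type*} [Fintype n] [DecidableEq n]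

/-! ### The geometric mean of `A` and the pseudo-inverse of `B` -/

/-- On an eigenvector `v` with value `g`, the form of `B - G B G` is `(1 - g²) ⟨v, B v⟩`. If `g > 1`
this forces `B v = 0`, hence `G v = 0` since `G` lives on the support of `B`, a contradiction. -/
theorem eigenvalues_le_one_of_sandwich_le {B G : Matrix n n ℂ} (hB : B.PosSemidef)
    (hG : G.IsHermitian) (hGB : G * suppProj B = G) (h : (B - G * B * G).PosSemidef) (i : n) :
    hG.eigenvalues i ≤ 1 := by
  set g := hG.eigenvalues i with hg
  set v : n → ℂ := ⇑(hG.eigenvectorBasis i) with hv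
  have hGv : G *ᵥ v = g • v := hG.mulVec_eigenvectorBasis i
  have hv0 : v ≠ 0 := fun h0 => hG.eigenvectorBasis.orthonormal.ne_zero i (by
    ext j
    exact congrFun h0 j)
  have hvG : star v ᵥ* G = g • star v := by
    have := congrArg star hGv
    rwa [star_mulVec, hG.eq, star_smul, star_trivial g] at this
  have h1 := h.dotProduct_mulVec_nonneg v
  have e : star v ⬝ᵥ ((B - G * B * G) *ᵥ v) = (1 - g ^ 2) • (star v ⬝ᵥ (B *ᵥ v)) := by
    rw [sub_mulVec, dotProduct_sub, ← mulVec_mulVec, hGv, ← mulVec_mulVec, mulVec_smul, mulVec_smul,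
      dotProduct_smul, dotProduct_mulVec _ G, hvG, smul_dotProduct, smul_smul, sub_smul, one_smul,
      sq]
  rw [e] at h1
  by_contra! hlt
  have h2 := hB.dotProduct_mulVec_nonneg v
  have h3 : star v ⬝ᵥ (B *ᵥ v) = 0 := by
    rw [Complex.nonneg_iff] at h1 h2
    rw [Complex.smul_re, smul_eq_mul] at h1
    refine Complex.ext ?_ h2.2.symm
    have hg2 : 1 - g ^ 2 < 0 := by nlinarith
    exact le_antisymm (not_lt.1 fun hr => h1.1.not_gt (mul_neg_of_neg_of_pos hg2 hr)) h2.1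
  have h4 : B *ᵥ v = 0 := (hB.dotProduct_mulVec_zero_iff v).1 h3
  have h5 : G *ᵥ v = 0 := by
    rw [← hGB, suppProj_eq hB.1, ← mulVec_mulVec, ← mulVec_mulVec, h4, mulVec_zero, mulVec_zero]
  rw [hGv, smul_eq_zero] at h5
  rcases h5 with h5 | h5
  · linarith
  · exact hv0 h5

/-- If `0 ≤ A ≤ B`, then `A = G B G` for some `0 ≤ G ≤ 1`. -/
theorem exists_sandwich_eq {A B : Matrix n n ℂ} (hA : A.PosSemidef) (hB : B.PosSemidef)
    (h : (B - A).PosSemidef) :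
    ∃ G : Matrix n n ℂ, G * B * G = A ∧ G.IsHermitian ∧ (G - G * G).PosSemidef ∧
      (1 - G * G).PosSemidef := by
  set R := msqrt B with hR
  set S := msqrtInv B with hS
  have hRH : Rᴴ = R := msqrt_isHermitian B
  have hSH : Sᴴ = S := msqrtInv_isHermitian B
  have hSR : S * R = suppProj B := msqrtInv_mul_msqrt hB
  have hRS : R * S = suppProj B := msqrt_mul_msqrtInv hB
  have hAs : A * suppProj B = A := by
    have := mul_suppProj_of_le (N := msqrt A) hB.1 (by
      rwa [(msqrt_isHermitian A).eq, msqrt_mul_msqrt hA])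
    conv_lhs => rw [← msqrt_mul_msqrt hA]
    rw [Matrix.mul_assoc, this, msqrt_mul_msqrt hA]
  have hsA : suppProj B * A = A := by
    have := congrArg conjTranspose hAs
    rwa [conjTranspose_mul, hA.1.eq, (suppProj_isHermitian B).eq] at this
  have hT : (R * A * R).PosSemidef := by
    have := hA.conjTranspose_mul_mul_same R
    rwa [hRH] at this
  -- The witness is `G = B^(-1/2) (B^(1/2) A B^(1/2))^(1/2) B^(-1/2)`, the positive solution of `G B
  -- G = A`. Inverses are harmless because `A ≤ B` puts the support of `A` inside that of `B`.
  set M := msqrt (R * A * R) with hM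
  have hMP : M.PosSemidef := msqrt_posSemidef hT.1
  have hMM : M * M = R * A * R := msqrt_mul_msqrt hT
  have hRs : R * suppProj B = R := by
    rw [hR, msqrt, suppProj, cfc_mul_cfc]
    refine cfc_congr_eigenvalues hB.1 fun i => ?_
    rcases eq_or_ne (hB.1.eigenvalues i) 0 with h | h
    · simp [h]
    · simp [h]
  have hMs : M * suppProj B = M := by
    have : Mᴴ * M * (1 - suppProj B) = 0 := by
      rw [hMP.1.eq, hMM, Matrix.mul_sub, Matrix.mul_one, Matrix.mul_assoc _ R, hRs, sub_self]
    rw [conjTranspose_mul_self_mul_eq_zero, Matrix.mul_sub, Matrix.mul_one, sub_eq_zero] at this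
    exact this.symm
  have hG : (S * M * S).PosSemidef := by
    have := hMP.conjTranspose_mul_mul_same S
    rwa [hSH] at this
  have hSBS : S * B * S = suppProj B := by
    rw [msqrtInv_mul_self hB, hRS]
  have hGBG : S * M * S * B * (S * M * S) = A := by
    have : S * M * S * B * (S * M * S) = S * (M * (S * B * S) * M) * S := by
      simp only [Matrix.mul_assoc]
    rw [this, hSBS, hMs, hMM]
    have : S * (R * A * R) * S = S * R * A * (R * S) := by simp only [Matrix.mul_assoc]
    rw [this, hSR, hRS, hsA, hAs]
  have hle := eigenvalues_le_one_of_sandwich_le hB hG.1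
    (by rw [Matrix.mul_assoc, msqrtInv_mul_suppProj hB]) (by rwa [hGBG])
  have hGG : S * M * S * (S * M * S) = cfc (fun x : ℝ => x * x) (S * M * S) := by
    rw [← cfc_mul_cfc, cfc_id_of_isHermitian hG.1]
  refine ⟨S * M * S, hGBG, hG.1, ?_, ?_⟩
  · have e : S * M * S - S * M * S * (S * M * S)
        = cfc (fun x : ℝ => x - x * x) (S * M * S) := by
      rw [hGG, ← cfc_sub_cfc, cfc_id_of_isHermitian hG.1]
    rw [e]
    exact cfc_posSemidef hG.1 fun i => by nlinarith [hle i, hG.eigenvalues_nonneg i]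
  · have e : 1 - S * M * S * (S * M * S) = cfc (fun x : ℝ => 1 - x * x) (S * M * S) := by
      rw [hGG, ← cfc_sub_cfc, cfc_const_one ℝ _ hG.1.isSelfAdjoint]
    rw [e]
    exact cfc_posSemidef hG.1 fun i => by nlinarith [hle i, hG.eigenvalues_nonneg i]

/-! ### Smoothing -/

/-- With `τ = G ρ G / t`, the modulus of `√ρ G / √t` is `√τ`. Its polar factor `W` gives `√τ Wᴴ = G
√ρ / √t`, so testing `√ρ √τ` against the contraction `Wᴴ` yields the left side exactly. -/
theorem re_trace_div_sqrt_le_traceNorm {ρ G : Matrix n n ℂ} (hρ : ρ.PosSemidef)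
    (hG : G.IsHermitian) {t : ℝ} (ht : 0 < t) :
    (ρ * G).trace.re / Real.sqrt t ≤ traceNorm (msqrt ρ * msqrt (t⁻¹ • (G * ρ * G))) := by
  set c : ℝ := (Real.sqrt t)⁻¹ with hc
  have hcc : c * c = t⁻¹ := by rw [hc, ← mul_inv, Real.mul_self_sqrt ht.le]
  obtain ⟨W, hW, -, -, hWW⟩ := polar_decomposition (c • (msqrt ρ * G))
  have hN : (c • (msqrt ρ * G))ᴴ = c • (G * msqrt ρ) := by
    rw [conjTranspose_smul, conjTranspose_mul, hG.eq, (msqrt_isHermitian ρ).eq, star_trivial]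
  have hNN : (c • (msqrt ρ * G))ᴴ * (c • (msqrt ρ * G)) = t⁻¹ • (G * ρ * G) := by
    rw [hN, smul_mul_smul_comm, hcc]
    congr 1
    rw [Matrix.mul_assoc, ← Matrix.mul_assoc (msqrt ρ), msqrt_mul_msqrt hρ, Matrix.mul_assoc]
  rw [hNN] at hW
  have hK : (1 - Wᴴᴴ * Wᴴ).PosSemidef := by rwa [conjTranspose_conjTranspose]
  refine le_trans (le_of_eq ?_) (re_trace_mul_le_traceNorm _ hK)
  have hW' := congrArg conjTranspose hW
  rw [hN, conjTranspose_mul, (msqrt_isHermitian _).eq] at hW'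
  rw [Matrix.trace_mul_comm Wᴴ, Matrix.mul_assoc, hW', mul_smul_comm, ← Matrix.mul_assoc,
    Matrix.trace_smul, Matrix.trace_mul_comm (msqrt ρ * G), ← Matrix.mul_assoc,
    msqrt_mul_msqrt hρ, Complex.smul_re, smul_eq_mul, hc, div_eq_inv_mul]

/-- If `ρ ≤ B` and `0 ≤ A ≤ B` with `Tr (B - A) ≤ x`, then a state of fidelity at least `1 - x` with
`ρ` lies below `(1 - x)⁻¹ A`. -/
theorem exists_state_le_of_le {ρ A B : Matrix n n ℂ} (hρ : IsState ρ) (hA : A.PosSemidef)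
    (hAB : (B - A).PosSemidef) (hρB : (B - ρ).PosSemidef) {x : ℝ} (hx1 : x < 1)
    (hx : (B - A).trace.re ≤ x) :
    ∃ τ : Matrix n n ℂ, IsState τ ∧ ((1 - x)⁻¹ • A - τ).PosSemidef ∧ 1 - x ≤ fidelity ρ τ := by
  have hB : B.PosSemidef := by
    have := hA.add hAB
    rwa [add_sub_cancel] at this
  obtain ⟨G, hGBG, hG, hG1, hG2⟩ := exists_sandwich_eq hA hB hAB
  set t := (ρ * (G * G)).trace.re with ht
  have hρ1 : ρ.trace.re = 1 := by rw [hρ.2]; rfl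
  have hGρ : (G * ρ * G).PosSemidef := by
    have := hρ.1.conjTranspose_mul_mul_same G
    rwa [hG.eq] at this
  have htr : (G * ρ * G).trace = t := by
    have e : (G * ρ * G).trace = (ρ * (G * G)).trace := by
      rw [Matrix.mul_assoc, Matrix.trace_mul_comm, Matrix.mul_assoc]
    refine Complex.ext (by rw [e, Complex.ofReal_re]) ?_
    rw [Complex.ofReal_im]
    exact (Complex.nonneg_iff.1 hGρ.trace_nonneg).2.symm
  -- `1 - Tr(ρ G²) = Tr(ρ (1 - G²)) ≤ Tr(B (1 - G²)) = Tr(B - A) ≤ x`.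
  have ht1 : 1 - x ≤ t := by
    have h1 := trace_mul_mono hG2 hρB
    have e : ∀ C : Matrix n n ℂ,
        ((1 - G * G) * C).trace.re = C.trace.re - (C * (G * G)).trace.re := by
      intro C
      rw [Matrix.trace_mul_comm, Matrix.mul_sub, Matrix.mul_one, trace_sub, Complex.sub_re]
    have e2 : (B * (G * G)).trace = A.trace := by
      rw [← hGBG, ← Matrix.mul_assoc, Matrix.trace_mul_comm, Matrix.mul_assoc]
    rw [e, e, e2, hρ1, ← ht] at h1
    rw [trace_sub, Complex.sub_re] at hx
    linarith
  have ht0 : 0 < t := by linarith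
  refine ⟨t⁻¹ • (G * ρ * G), ⟨hGρ.smul (by positivity), ?_⟩, ?_, ?_⟩
  · rw [trace_smul, htr, Complex.real_smul, ← Complex.ofReal_mul, inv_mul_cancel₀ ht0.ne',
      Complex.ofReal_one]
  · have h1 : (t⁻¹ • (G * (B - ρ) * G)).PosSemidef := by
      have := hρB.conjTranspose_mul_mul_same G
      rw [hG.eq] at this
      exact this.smul (by positivity)
    have h2 : (((1 - x)⁻¹ - t⁻¹) • A).PosSemidef := by
      refine hA.smul (sub_nonneg.2 ?_)
      gcongr
    convert h1.add h2 using 1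
    rw [Matrix.mul_sub, Matrix.sub_mul, hGBG, smul_sub, sub_smul]
    abel
  · have h1 := re_trace_div_sqrt_le_traceNorm hρ.1 hG ht0
    -- `G² ≤ G`, since `0 ≤ G ≤ 1`.
    have h2 : t ≤ (ρ * G).trace.re := trace_mul_mono hρ.1 hG1
    have h3 : Real.sqrt t ≤ (ρ * G).trace.re / Real.sqrt t := by
      rw [le_div_iff₀ (Real.sqrt_pos.2 ht0), Real.mul_self_sqrt ht0.le]
      exact h2
    have h4 := pow_le_pow_left₀ (Real.sqrt_nonneg t) (h3.trans h1) 2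
    rw [Real.sq_sqrt ht0.le] at h4
    exact ht1.trans h4

/-- At the threshold `log λ = (D + 1) / x + log x + log (1 - x)`, the positive part of `ρ - λ σ` has
trace at most `x`. -/
theorem trace_posPart_le {ρ σ : Matrix n n ℂ} (hρ : IsState ρ) (hσ : IsState σ)
    (hsupp : LinearMap.range ρ.mulVecLin ≤ LinearMap.range σ.mulVecLin) {x l : ℝ} (hx0 : 0 < x)
    (hx1 : x < 1) (hl : 0 < l)
    (hll : Real.log l = (Real.log 2 * (ρ * (mlog ρ - mlog σ)).trace.re + Real.log 2) / x
      + Real.log x + Real.log (1 - x)) :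
    (cfc (fun y : ℝ => max y 0) (ρ - l • σ)).trace.re ≤ x := by
  have hH : (ρ - l • σ).IsHermitian := hρ.1.1.sub (hσ.1.1.smul (by simp [IsSelfAdjoint]))
  set P := cfc (fun x : ℝ => if 0 < x then (1 : ℝ) else 0) (ρ - l • σ) with hPdef
  have hP : P.IsHermitian := cfc_isHermitian _ _
  have hPP : P * P = P := indicator_cfc_mul_self _
  have hQ : cfc (fun y : ℝ => max y 0) (ρ - l • σ) = (ρ - l • σ) * P := by
    have e : (ρ - l • σ) * P = cfc (fun y : ℝ => y * if 0 < y then 1 else 0) (ρ - l • σ) := by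
      rw [← cfc_mul_cfc, cfc_id_of_isHermitian hH]
    rw [e]
    congr 1
    funext y
    split_ifs with h
    · rw [max_eq_left h.le, mul_one]
    · rw [max_eq_right (not_lt.1 h), mul_zero]
  set D := Real.log 2 * (ρ * (mlog ρ - mlog σ)).trace.re with hD
  set p := (ρ * P).trace.re with hp
  set q := (σ * P).trace.re with hq
  have hρ1 : ρ.trace.re = 1 := by rw [hρ.2]; rfl
  have hσ1 : σ.trace.re = 1 := by rw [hσ.2]; rfl
  have htr : (cfc (fun y : ℝ => max y 0) (ρ - l • σ)).trace.re = p - l * q := by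
    rw [hQ, Matrix.sub_mul, smul_mul_assoc, trace_sub, trace_smul, Complex.sub_re, Complex.smul_re,
      smul_eq_mul]
  rw [htr]
  by_contra! hlt
  have hq0 : 0 ≤ q := trace_mul_nonneg hσ.1 (projection_posSemidef hP hPP)
  have hxp : x < p := by nlinarith
  have hp0 : 0 < p := hx0.trans hxp
  have hp1 : p ≤ 1 := by
    have := trace_mul_mono hρ.1 (one_sub_projection_posSemidef hP hPP)
    rwa [Matrix.mul_one, hρ1] at this
  -- Nonnegativity of the relative entropy is data processing for the trivial measurement `P = 1`,
  -- `b = 1`.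
  have hD0 : 0 ≤ D := by
    have := binary_le_relEntropy hρ hσ hsupp isHermitian_one (Matrix.one_mul 1) one_pos
      (by rw [Matrix.mul_one, hσ1])
    rw [Matrix.mul_one, hρ1] at this
    simpa using this
  -- The contrary assumption `p - l q > x` says that `q` is below this value.
  have hb : 0 < (p - x) / l := div_pos (by linarith) hl
  have h1 := binary_le_relEntropy hρ hσ hsupp hP hPP hb (by
    rw [← hq, le_div_iff₀ hl]
    linarith)
  rw [← hp, ← hD, Real.log_div (by linarith) hl.ne', hll] at h1
  have h2 := neg_mul_log_lt hx0 hxp hp1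
  -- `p - x ≤ p (1 - x)` because `p ≤ 1`; this uses up the `log (1 - x)` in the threshold.
  have h3 : Real.log (p - x) ≤ Real.log p + Real.log (1 - x) := by
    rw [← Real.log_mul hp0.ne' (by linarith)]
    refine Real.log_le_log (by linarith) ?_
    nlinarith
  have h4 := mul_le_mul_of_nonneg_left h3 hp0.le
  have h5 : D ≤ p * (D / x) := by
    rw [← mul_div_assoc, le_div_iff₀ hx0, mul_comm p]
    gcongr
  rw [add_div] at h1
  nlinarith

theorem exists_mem_purifiedBall {ρ σ : Matrix n n ℂ} (hρ : IsState ρ) (hσ : IsState σ)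
    (hsupp : LinearMap.range ρ.mulVecLin ≤ LinearMap.range σ.mulVecLin) {ε : ℝ} (hε0 : 0 < ε)
    (hε1 : ε < 1) :
    ∃ τ ∈ purifiedBall ε ρ, Dmax τ σ ≤
      ((((ρ * (mlog ρ - mlog σ)).trace.re + 1) / ε ^ 2 - Real.logb 2 (1 / ε ^ 2) : ℝ) : EReal) := by
  set D := (ρ * (mlog ρ - mlog σ)).trace.re with hD
  set x := ε ^ 2 with hx
  have hx0 : 0 < x := by positivity
  have hx1 : x < 1 := by rw [hx]; nlinarith
  have hl2 : 0 < Real.log 2 := Real.log_pos one_lt_two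
  set l := Real.exp ((Real.log 2 * D + Real.log 2) / x + Real.log x + Real.log (1 - x)) with hl
  have hl0 : 0 < l := Real.exp_pos _
  have hll : Real.log l = (Real.log 2 * D + Real.log 2) / x + Real.log x + Real.log (1 - x) :=
    Real.log_exp _
  have hQ := trace_posPart_le hρ hσ hsupp hx0 hx1 hl0 hll
  have hH : (ρ - l • σ).IsHermitian := hρ.1.1.sub (hσ.1.1.smul (by simp [IsSelfAdjoint]))
  set Q := cfc (fun y : ℝ => max y 0) (ρ - l • σ) with hQdef
  have hQ0 : Q.PosSemidef := cfc_posSemidef hH fun i => le_max_right _ _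
  have hQ1 : (Q - (ρ - l • σ)).PosSemidef := by
    have e : Q - (ρ - l • σ) = cfc (fun y : ℝ => max y 0 - y) (ρ - l • σ) := by
      rw [← cfc_sub_cfc, cfc_id_of_isHermitian hH]
    rw [e]
    exact cfc_posSemidef hH fun i => sub_nonneg.2 (le_max_left _ _)
  -- The resulting multiple of `σ` is `l / (1 - x)`, whose base-2 logarithm is exactly `(D + 1) / x
  -- + log x`.
  obtain ⟨τ, hτ, hle, hF⟩ := exists_state_le_of_le (A := l • σ) (B := l • σ + Q) hρ
    (hσ.1.smul hl0.le) (by rwa [add_sub_cancel_left])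
    (by convert hQ1 using 1; abel) hx1 (by rwa [add_sub_cancel_left])
  refine ⟨τ, ⟨?_, hτ⟩, ?_⟩
  · rw [purifiedDist]
    refine Real.sqrt_le_iff.2 ⟨hε0.le, ?_⟩
    linarith
  · rw [smul_smul] at hle
    have h1x : 0 < 1 - x := by linarith
    refine (Dmax_le_of_posSemidef (by positivity) hle).trans (le_of_eq ?_)
    congr 1
    rw [Real.logb, Real.logb, Real.log_mul (inv_pos.2 h1x).ne' hl0.ne', Real.log_inv, hll, one_div,
      Real.log_inv]
    field_simp
    ring

end

end SmoothDivergence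
end

/-! ### The two inequalities -/

theorem mainTheorem11 {n : Type*} [Fintype n] [DecidableEq n] (ρ σ : Matrix n n ℂ)
    (hρ : SmoothDivergence.IsState ρ) (hσ : SmoothDivergence.IsState σ)
    (ε : ℝ) (hε0 : 0 < ε) (hε1 : ε < 1) :
    SmoothDivergence.DmaxTrace ε ρ σ ≤ SmoothDivergence.DmaxPurified ε ρ σ ∧
      SmoothDivergence.DmaxPurified ε ρ σ ≤
        (SmoothDivergence.relEntropy ρ σ + 1) / ((ε ^ 2 : ℝ) : EReal)
          - ((Real.logb 2 (1 / ε ^ 2) : ℝ) : EReal) := by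
  refine ⟨biInf_mono fun τ hτ =>
    ⟨(SmoothDivergence.traceDist_le_purifiedDist hρ hτ.2).trans hτ.1, hτ.2⟩, ?_⟩
  rw [SmoothDivergence.relEntropy]
  split_ifs with h
  · obtain ⟨τ, hτ, hle⟩ := SmoothDivergence.exists_mem_purifiedBall hρ hσ h hε0 hε1
    refine (iInf₂_le τ hτ).trans (hle.trans (le_of_eq ?_))
    rw [EReal.coe_sub, EReal.coe_div, EReal.coe_add, EReal.coe_one]
  -- Outside the support condition the right side is `⊤`: dividing by a positive real and
  -- subtracting a real preserve it.
  · have hε : (0 : EReal) < ((ε ^ 2 : ℝ) : EReal) := by exact_mod_cast pow_pos hε0 2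
    have e : (⊤ : EReal) + 1 = ⊤ := EReal.top_add_coe 1
    rw [e, EReal.top_div_of_pos_ne_top hε (EReal.coe_ne_top _), EReal.top_sub_coe]
    exact le_top
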